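/- \textbf{Theorem.} Let $\mathbb{C}$ be a pretopos (a category that is exact in the sense of Barr and finitarily extensive) which has finite colimits. Then the opposite category $\mathbb{C}^{\mathrm{op}}$ is arithmetical and ideally exact. (In other words, a finitely cocomplete pretopos is co-arithmetical and co-ideally-exact.) Here the following definitions are used. \begin{itemize} \item A category is \emph{regular} if it has finite limits, every kernel pair has a coequalizer, and regular epimorphisms are stable under pullback; it is \emph{exact} if moreover every internal equivalence relation is effective, i.e. is the kernel pair of some morphism. A category is \emph{extensive} if it has finite coproducts and, for all objects $A,B$, the coproduct functor $(\mathbb{C}\downarrow A)\times(\mathbb{C}\downarrow B)\to(\mathbb{C}\downarrow A+B)$ is an equivalence; equivalently, it has finite coproducts, pullbacks of coproduct inclusions along arbitrary morphisms exist, and whenever $A'\to C'\leftarrow B'$ is a coproduct diagram and $h:C\to C'$, $f:A\to A'$, $g:B\to B'$, $i:A\to C$, $j:B\to C$ make the two evident squares commute, $(C,i,j)$ is a coproduct of $A$ and $B$ if and only if both squares are pullbacks. \item For an object $B$, $\mathbf{Pt}(B)$ is the category of triples $(A,\alpha:A\to B,\beta:B\to A)$ with $\alpha\beta=1_B$, whose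 morphisms are the morphisms commuting with the $\alpha$'s and the $\beta$'s. A category is \emph{protomodular} if pullbacks of split epimorphisms along arbitrary morphisms exist and, for every morphism $p:E\to B$, the pullback functor $p^*:\mathbf{Pt}(B)\to\mathbf{Pt}(E)$ reflects isomorphisms. \item A category is \emph{ideally exact} if it is exact, protomodular and finitely cocomplete, and the unique morphism $0\to 1$ from the initial to the terminal object is a regular epimorphism. \item A \emph{Mal'tsev category} is a category with finite limits in which every internal reflexive relation is an equivalence relation. A Mal'tsev category is \emph{arithmetical} if, for every object $X$, the internal equivalence relations on $X$ (as subobjects of $X\times X$, ordered by inclusion) form a distributive lattice. \end{itemize} -/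

import Mathlib

open CategoryTheory CategoryTheory.Limits

universe v u

/-- A regular category is (Barr-)exact when every internal equivalence relation is effective,
that is, its projections form the kernel pair of some morphism. -/
class IsBarrExact (C : Type u) [Category.{v} C] : Prop extends Regular C where
  effective : ∀ {R X : C} (p₁ p₂ : R ⟶ X), IsEquivalenceRelation p₁ p₂ →
    ∃ (Y : C) (f : X ⟶ Y), IsKernelPair f p₁ p₂

/-- A pretopos is a category which is exact and (finitary) extensive. -/
class IsPretopos (C : Type u) [Category.{v} C] : Prop extends
  IsBarrExact C, FinitaryExtensive C

/-- Pullbacks of split epimorphisms along arbitrary morphisms exist. -/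
class HasPullbacksOfSplitEpis (C : Type u) [Category.{v} C] : Prop where
  hasPullback : ∀ {E A B : C} (p : E ⟶ B) (α : A ⟶ B), IsSplitEpi α → HasPullback p α

/-- A point over `B`: an object of the category `Pt(B)`, i.e. a morphism to `B`
together with a chosen section. -/
structure SplitPoint {C : Type u} [Category.{v} C] (B : C) where
  obj : C
  proj : obj ⟶ B
  sect : B ⟶ obj
  sect_proj : sect ≫ proj = 𝟙 B

namespace SplitPoint

/-- Morphisms of points commute with the projections and with the sections. -/
@[ext]
structure Hom {C : Type u} [Category.{v} C] {B : C} (P Q : SplitPoint B) where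
  hom : P.obj ⟶ Q.obj
  hom_proj : hom ≫ Q.proj = P.proj
  sect_hom : P.sect ≫ hom = Q.sect

/-- The category `Pt(B)` of points over `B`. -/
instance category {C : Type u} [Category.{v} C] (B : C) : Category.{v} (SplitPoint B) where
  Hom P Q := Hom P Q
  id P := ⟨𝟙 P.obj, Category.id_comp _, Category.comp_id _⟩
  comp f g := ⟨f.hom ≫ g.hom,
    by rw [Category.assoc, g.hom_proj, f.hom_proj],
    by rw [← Category.assoc, f.sect_hom, g.sect_hom]⟩
  id_comp _ := Hom.ext (Category.id_comp _)
  comp_id _ := Hom.ext (Category.comp_id _)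
  assoc _ _ _ := Hom.ext (Category.assoc _ _ _)

theorem hasPullback {C : Type u} [Category.{v} C] [HasPullbacksOfSplitEpis C] {E B : C}
    (p : E ⟶ B) (P : SplitPoint B) : HasPullback p P.proj :=
  HasPullbacksOfSplitEpis.hasPullback p P.proj ⟨⟨⟨P.sect, P.sect_proj⟩⟩⟩

attribute [instance] hasPullback

/-- The base change `(E ×_B A, π₁, ⟨1, β p⟩)` of the point `(A, α, β)` along `p : E ⟶ B`. -/
noncomputable def baseChangeObj {C : Type u} [Category.{v} C] [HasPullbacksOfSplitEpis C]
    {E B : C} (p : E ⟶ B) (P : SplitPoint B) : SplitPoint E where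
  obj := pullback p P.proj
  proj := pullback.fst p P.proj
  sect := pullback.lift (𝟙 E) (p ≫ P.sect)
    (by rw [Category.id_comp, Category.assoc, P.sect_proj, Category.comp_id])
  sect_proj := pullback.lift_fst _ _ _

/-- The underlying morphism of `p^*(f)`, determined by `π₁' p^*(f) = π₁` and
`π₂' p^*(f) = f π₂`. -/
noncomputable def baseChangeMap {C : Type u} [Category.{v} C] [HasPullbacksOfSplitEpis C]
    {E B : C} (p : E ⟶ B) {P Q : SplitPoint B} (f : Hom P Q) :
    pullback p P.proj ⟶ pullback p Q.proj :=
  pullback.lift (pullback.fst p P.proj) (pullback.snd p P.proj ≫ f.hom)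
    (by rw [Category.assoc, f.hom_proj]; exact pullback.condition)

theorem sect_baseChangeMap {C : Type u} [Category.{v} C] [HasPullbacksOfSplitEpis C]
    {E B : C} (p : E ⟶ B) {P Q : SplitPoint B} (f : Hom P Q) :
    (baseChangeObj p P).sect ≫ baseChangeMap p f = (baseChangeObj p Q).sect := by
  unfold baseChangeMap baseChangeObj
  apply pullback.hom_ext
  · rw [Category.assoc, pullback.lift_fst, pullback.lift_fst, pullback.lift_fst]
  · rw [Category.assoc, pullback.lift_snd, pullback.lift_snd, ← Category.assoc,
      pullback.lift_snd, Category.assoc, f.sect_hom]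

theorem baseChangeMap_comp {C : Type u} [Category.{v} C] [HasPullbacksOfSplitEpis C]
    {E B : C} (p : E ⟶ B) {P Q R : SplitPoint B} (f : P ⟶ Q) (g : Q ⟶ R) :
    baseChangeMap p (f ≫ g) = baseChangeMap p f ≫ baseChangeMap p g := by
  unfold baseChangeMap
  apply pullback.hom_ext
  · rw [Category.assoc, pullback.lift_fst, pullback.lift_fst, pullback.lift_fst]
  · rw [Category.assoc, pullback.lift_snd, pullback.lift_snd, ← Category.assoc,
      pullback.lift_snd, Category.assoc]
    rfl

/-- The change-of-base functor `p^* : Pt(B) ⥤ Pt(E)` along `p : E ⟶ B`. -/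
noncomputable def baseChange {C : Type u} [Category.{v} C] [HasPullbacksOfSplitEpis C] {E B : C}
    (p : E ⟶ B) : SplitPoint B ⥤ SplitPoint E where
  obj P := baseChangeObj p P
  map f := ⟨baseChangeMap p f, pullback.lift_fst _ _ _, sect_baseChangeMap p f⟩
  map_id P := by
    apply Hom.ext
    apply pullback.hom_ext
    · exact (pullback.lift_fst _ _ _).trans (Category.id_comp _).symm
    · exact (pullback.lift_snd _ _ _).trans
        ((Category.comp_id _).trans (Category.id_comp _).symm)
  map_comp f g := Hom.ext (baseChangeMap_comp p f g)

end SplitPoint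

/-- A category is (Bourn-)protomodular when pullbacks of split epimorphisms along arbitrary
morphisms exist and every change-of-base functor between categories of points reflects
isomorphisms. -/
class IsProtomodular (C : Type u) [Category.{v} C] : Prop extends HasPullbacksOfSplitEpis C where
  reflectsIsomorphisms : ∀ {E B : C} (p : E ⟶ B),
    (SplitPoint.baseChange p).ReflectsIsomorphisms

/-- A category is ideally exact when it is exact, protomodular, finitely cocomplete, and the
unique morphism from the initial to the terminal object is a regular epimorphism. -/
class IsIdeallyExact (C : Type u) [Category.{v} C] : Prop extends
    IsBarrExact C, IsProtomodular C where
  [hasFiniteColimits : HasFiniteColimits C]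
  isRegularEpi_initial_to_terminal : IsRegularEpi (initial.to (⊤_ C))

/-- A Mal'tsev category is a finitely complete category in which every internal reflexive relation
is an equivalence relation. -/
class IsMaltsev (C : Type u) [Category.{v} C] : Prop extends HasFiniteLimits C where
  isEquivalenceRelation : ∀ {R X : C} (p₁ p₂ : R ⟶ X), ReflexiveRelation p₁ p₂ →
    IsEquivalenceRelation p₁ p₂

/-- The internal equivalence relations on `X`, as subobjects of `X ⨯ X`, ordered by inclusion. -/
abbrev EquivRelOn {C : Type u} [Category.{v} C] [HasBinaryProducts C] (X : C) : Type (max u v) :=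
  {R : Subobject (X ⨯ X) //
    IsEquivalenceRelation (R.arrow ≫ prod.fst) (R.arrow ≫ prod.snd)}

/-- The given partial order is a lattice order (all binary meets and joins exist), and this lattice
is distributive. -/
def IsDistribLatticeOrder (P : Type*) [inst : PartialOrder P] : Prop :=
  ∃ L : DistribLattice P, L.toPartialOrder = inst

/-- A Mal'tsev category is arithmetical when, for each object, the equivalence relations on that
object form a distributive lattice. -/
class IsArithmetical (C : Type u) [Category.{v} C] : Prop extends IsMaltsev C where
  isDistribLatticeOrder : ∀ X : C, IsDistribLatticeOrder (EquivRelOn X)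

-- A pretopos admits set-like reasoning with generalized elements: an element of the target of a
-- jointly covering pair comes, locally, from one of the two sources, and equality and membership in
-- a subobject can be tested locally. Hence, as for sets, gluing `X` to `Y` along a mono `m : A ⟶ X`
-- and a map `f : A ⟶ Y` keeps `Y` embedded, makes the glued parts meet exactly in `A`, and
-- identifies two elements of `X` only if they are equal or come from elements of `A` with the same
-- image under `f` (`exists_amalgam`).
--
-- The dual statements follow. Monos are regular and stable under pushout, so regular epis in the
-- opposite category are pullback-stable. A coreflexive corelation is the cokernel pair of its
-- equalizer (`isPushout_of_coreflexive`), which gives effectiveness and the Mal'tsev property. It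
-- also makes equivalence relations in the opposite category anti-isomorphic to subobjects in `C`,
-- whose lattice is distributive by `subobject_inf_sup_le`. Protomodularity is `isIso_of_isPushout`:
-- pushing out along `p` alters only the common subobject `B`. Finally, the map from the initial to
-- the terminal object of `C` is monic.

attribute [local simp] prod.lift_fst prod.lift_snd coprod.inl_desc coprod.inr_desc
  prod.lift_fst_assoc prod.lift_snd_assoc coprod.inl_desc_assoc coprod.inr_desc_assoc
  pullback.lift_fst_assoc pullback.lift_snd_assoc

/-! ### Covers by two morphisms and local arguments -/

section JointCover

variable {C : Type u} [Category.{v} C]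

/-- Two morphisms with the same target cover it when the induced morphism from the coproduct is a
regular epimorphism. -/
def JointCover [HasBinaryCoproducts C] {T₁ T₂ T : C} (c₁ : T₁ ⟶ T) (c₂ : T₂ ⟶ T) : Prop :=
  IsRegularEpi (coprod.desc c₁ c₂)

/-- In a finitary extensive category with pullbacks, a morphism to a coproduct splits its source
as a coproduct. -/
theorem exists_isColimit_binaryCofan_of_hom_coprod [HasPullbacks C] [FinitaryExtensive C]
    {T X Y : C} (x : T ⟶ X ⨿ Y) :
    ∃ (T₁ T₂ : C) (c₁ : T₁ ⟶ T) (c₂ : T₂ ⟶ T) (x₁ : T₁ ⟶ X) (x₂ : T₂ ⟶ Y),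
      Nonempty (IsColimit (BinaryCofan.mk c₁ c₂)) ∧
      c₁ ≫ x = x₁ ≫ coprod.inl ∧ c₂ ≫ x = x₂ ≫ coprod.inr := by
  have hv := FinitaryExtensive.vanKampen _ (coprodIsCoprod X Y)
  refine ⟨pullback x coprod.inl, pullback x coprod.inr, pullback.fst _ _, pullback.fst _ _,
    pullback.snd _ _, pullback.snd _ _, ?_, pullback.condition, pullback.condition⟩
  refine ((BinaryCofan.isVanKampen_iff _).mp hv (BinaryCofan.mk (pullback.fst x coprod.inl)
    (pullback.fst x coprod.inr)) (pullback.snd _ _) (pullback.snd _ _) x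
    pullback.condition.symm pullback.condition.symm).mpr ⟨?_, ?_⟩
  · exact IsPullback.of_hasPullback _ _
  · exact IsPullback.of_hasPullback _ _

/-- The images of the two coproduct inclusions are disjoint. -/
theorem nonempty_isInitial_of_comp_inl_eq_comp_inr [FinitaryExtensive C] {T X Y : C}
    {x : T ⟶ X} {y : T ⟶ Y} (h : x ≫ (coprod.inl : X ⟶ X ⨿ Y) = y ≫ coprod.inr) :
    Nonempty (IsInitial T) := by
  have hp := FinitaryExtensive.isPullback_initial_to_binaryCofan (coprodIsCoprod X Y)
  have := initialIsInitial.isIso_to (hp.lift x y h)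
  exact ⟨initialIsInitial.ofIso (asIso (hp.lift x y h)).symm⟩

theorem JointCover.of_isColimit_comp [HasBinaryCoproducts C] {T₁ T₂ T Z : C} {c₁ : T₁ ⟶ T}
    {c₂ : T₂ ⟶ T} (h : IsColimit (BinaryCofan.mk c₁ c₂)) (e : T ⟶ Z) [IsRegularEpi e] :
    JointCover (c₁ ≫ e) (c₂ ≫ e) := by
  let i : T₁ ⨿ T₂ ≅ T := (coprodIsCoprod T₁ T₂).coconePointUniqueUpToIso h
  have h₁ : coprod.inl ≫ i.hom = c₁ :=
    (coprodIsCoprod T₁ T₂).comp_coconePointUniqueUpToIso_hom h ⟨WalkingPair.left⟩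
  have h₂ : coprod.inr ≫ i.hom = c₂ :=
    (coprodIsCoprod T₁ T₂).comp_coconePointUniqueUpToIso_hom h ⟨WalkingPair.right⟩
  have : coprod.desc (c₁ ≫ e) (c₂ ≫ e) = i.hom ≫ e := by
    apply coprod.hom_ext <;> simp [← h₁, ← h₂]
  unfold JointCover
  rw [this]
  exact (MorphismProperty.cancel_left_of_respectsIso (.regularEpi C) i.hom e).mpr
    (show IsRegularEpi e from inferInstance)

theorem JointCover.of_isColimit [HasBinaryCoproducts C] {T₁ T₂ T : C} {c₁ : T₁ ⟶ T}
    {c₂ : T₂ ⟶ T} (h : IsColimit (BinaryCofan.mk c₁ c₂)) : JointCover c₁ c₂ := by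
  have : IsRegularEpi (𝟙 T) := ⟨⟨RegularEpi.ofIso (Iso.refl T)⟩⟩
  simpa using JointCover.of_isColimit_comp h (𝟙 T)

theorem JointCover.hom_ext [HasBinaryCoproducts C] {T₁ T₂ T Z : C} {c₁ : T₁ ⟶ T} {c₂ : T₂ ⟶ T}
    (h : JointCover c₁ c₂) {x y : T ⟶ Z} (h₁ : c₁ ≫ x = c₁ ≫ y) (h₂ : c₂ ≫ x = c₂ ≫ y) :
    x = y := by
  have : IsRegularEpi (coprod.desc c₁ c₂) := h
  rw [← cancel_epi (coprod.desc c₁ c₂)]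
  apply coprod.hom_ext <;> simpa

/-- A morphism factors through a monomorphism as soon as it does so on a cover. -/
theorem JointCover.exists_factor [HasBinaryCoproducts C] {T₁ T₂ T U X : C} {c₁ : T₁ ⟶ T}
    {c₂ : T₂ ⟶ T} (h : JointCover c₁ c₂) (i : U ⟶ X) [Mono i] {x : T ⟶ X} {u₁ : T₁ ⟶ U}
    {u₂ : T₂ ⟶ U} (h₁ : u₁ ≫ i = c₁ ≫ x) (h₂ : u₂ ≫ i = c₂ ≫ x) : ∃ u : T ⟶ U, u ≫ i = x := by
  have : IsRegularEpi (coprod.desc c₁ c₂) := h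
  have sq : CommSq (coprod.desc u₁ u₂) (coprod.desc c₁ c₂) i x :=
    ⟨by apply coprod.hom_ext <;> simpa⟩
  exact ⟨sq.lift, sq.fac_right⟩

section Regular

variable [Regular C] [FinitaryExtensive C]

/-- Pull the regular epi `X ⨿ Y ⟶ Z` back along `z`; its pullback still covers `T`, and extensivity
splits the domain of that pullback in two. -/
theorem JointCover.exists_of_hom {X Y Z T : C} {a : X ⟶ Z} {b : Y ⟶ Z} (h : JointCover a b)
    (z : T ⟶ Z) :
    ∃ (T₁ T₂ : C) (c₁ : T₁ ⟶ T) (c₂ : T₂ ⟶ T) (t₁ : T₁ ⟶ X) (t₂ : T₂ ⟶ Y),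
      JointCover c₁ c₂ ∧ c₁ ≫ z = t₁ ≫ a ∧ c₂ ≫ z = t₂ ≫ b := by
  have : IsRegularEpi (coprod.desc a b) := h
  obtain ⟨T₁, T₂, c₁, c₂, x₁, x₂, ⟨hc⟩, h₁, h₂⟩ :=
    exists_isColimit_binaryCofan_of_hom_coprod (pullback.fst (coprod.desc a b) z)
  refine ⟨T₁, T₂, c₁ ≫ pullback.snd _ _, c₂ ≫ pullback.snd _ _, x₁, x₂, ?_, ?_, ?_⟩
  · exact JointCover.of_isColimit_comp hc _
  · rw [Category.assoc, ← pullback.condition, reassoc_of% h₁, coprod.inl_desc]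
  · rw [Category.assoc, ← pullback.condition, reassoc_of% h₂, coprod.inr_desc]

end Regular

end JointCover

/-! ### Effective quotients collapsing a subobject -/

section Collapse

variable {C : Type u} [Category.{v} C]

/-- The relation on generalized elements of `X` generated, locally, by identifying elements of
`m : S ⟶ X` with the same image under `h`. -/
def CollapseRel [HasBinaryCoproducts C] {S X Z T : C} (m : S ⟶ X) (h : S ⟶ Z) (x y : T ⟶ X) :
    Prop :=
  ∃ (T₁ T₂ : C) (c₁ : T₁ ⟶ T) (c₂ : T₂ ⟶ T), JointCover c₁ c₂ ∧ c₁ ≫ x = c₁ ≫ y ∧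
    ∃ s t : T₂ ⟶ S, s ≫ m = c₂ ≫ x ∧ t ≫ m = c₂ ≫ y ∧ s ≫ h = t ≫ h

section

variable [FinitaryExtensive C] {S X Z T : C} (m : S ⟶ X) (h : S ⟶ Z)

theorem CollapseRel.of_eq {x y : T ⟶ X} (e : x = y) : CollapseRel m h x y := by
  refine ⟨T, ⊥_ C, 𝟙 T, initial.to T, ?_, by rw [e], initial.to _, initial.to _,
    Subsingleton.elim _ _, Subsingleton.elim _ _, Subsingleton.elim _ _⟩
  exact JointCover.of_isColimit
    ((BinaryCofan.isColimit_iff_isIso_inl initialIsInitial _).mpr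
      (inferInstanceAs (IsIso (𝟙 T)))).some

theorem CollapseRel.of_factor (s t : T ⟶ S) (e : s ≫ h = t ≫ h) :
    CollapseRel m h (s ≫ m) (t ≫ m) := by
  refine ⟨⊥_ C, T, initial.to T, 𝟙 T, ?_, Subsingleton.elim _ _, s, t, by simp, by simp, e⟩
  exact JointCover.of_isColimit
    ((BinaryCofan.isColimit_iff_isIso_inr initialIsInitial _).mpr
      (inferInstanceAs (IsIso (𝟙 T)))).some

/-- The collapse relation is represented by a subobject of `X ⨯ X`. -/
theorem exists_jointlyMono₂_collapseRel [Regular C] :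
    ∃ (R : C) (p₁ p₂ : R ⟶ X), JointlyMono₂ p₁ p₂ ∧
      ∀ {T : C} (x y : T ⟶ X), (∃ g : T ⟶ R, g ≫ p₁ = x ∧ g ≫ p₂ = y) ↔ CollapseRel m h x y := by
  -- The relation is the image of this map: the union of the diagonal and the image under `m` of the
  -- kernel pair of `h`.
  let f : X ⨿ pullback h h ⟶ X ⨯ X := coprod.desc (prod.lift (𝟙 X) (𝟙 X))
    (prod.lift (pullback.fst h h ≫ m) (pullback.snd h h ≫ m))
  let F := Regular.strongEpiMonoFactorisation f
  have hF : coprod.desc (coprod.inl ≫ F.e) (coprod.inr ≫ F.e) = F.e := by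
    apply coprod.hom_ext <;> simp
  have cov : JointCover (coprod.inl ≫ F.e) (coprod.inr ≫ F.e) := by
    unfold JointCover
    rw [hF]
    infer_instance
  have e₁ : coprod.inl ≫ F.e ≫ F.m = prod.lift (𝟙 X) (𝟙 X) := by simp [f]
  have e₂ : coprod.inr ≫ F.e ≫ F.m =
      prod.lift (pullback.fst h h ≫ m) (pullback.snd h h ≫ m) := by simp [f]
  refine ⟨F.I, F.m ≫ prod.fst, F.m ≫ prod.snd, ⟨fun Y f g h₁ h₂ => ?_⟩, fun {T} x y => ⟨?_, ?_⟩⟩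
  · rw [← cancel_mono F.m]
    apply prod.hom_ext
    · simpa using h₁
    · simpa using h₂
  · rintro ⟨g, rfl, rfl⟩
    obtain ⟨T₁, T₂, c₁, c₂, t₁, t₂, hc, h₁, h₂⟩ := cov.exists_of_hom g
    refine ⟨T₁, T₂, c₁, c₂, hc, ?_, t₂ ≫ pullback.fst h h, t₂ ≫ pullback.snd h h, ?_, ?_, ?_⟩
    · simp only [reassoc_of% h₁, reassoc_of% e₁, prod.lift_fst, prod.lift_snd]
    · simp only [reassoc_of% h₂, reassoc_of% e₂, prod.lift_fst, Category.assoc]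
    · simp only [reassoc_of% h₂, reassoc_of% e₂, prod.lift_snd, Category.assoc]
    · simp [pullback.condition]
  · rintro ⟨T₁, T₂, c₁, c₂, hc, h₁, s, t, hs, ht, hst⟩
    obtain ⟨g, hg⟩ := hc.exists_factor F.m (x := prod.lift x y)
      (u₁ := (c₁ ≫ x) ≫ coprod.inl ≫ F.e) (u₂ := pullback.lift s t hst ≫ coprod.inr ≫ F.e)
      (by
        simp only [Category.assoc, e₁]
        apply prod.hom_ext
        · simp
        · simp [h₁])
      (by
        simp only [Category.assoc, e₂]
        apply prod.hom_ext <;> simp [hs, ht])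
    exact ⟨g, by rw [reassoc_of% hg, prod.lift_fst], by rw [reassoc_of% hg, prod.lift_snd]⟩

end

/-- In a pretopos, the elements of a subobject `m : S ⟶ X` with the same image under `h` can be
identified by a morphism with domain `X`, effectively. -/
theorem exists_collapse [IsPretopos C] {S X Z : C} (m : S ⟶ X) [Mono m] (h : S ⟶ Z) :
    ∃ (Q : C) (q : X ⟶ Q), ∀ {T : C} (x y : T ⟶ X), x ≫ q = y ≫ q ↔ CollapseRel m h x y := by
  obtain ⟨R, p₁, p₂, hm, hR⟩ := exists_jointlyMono₂_collapseRel m h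
  -- Membership in `R` is local, because `R` is a subobject of `X ⨯ X`.
  have hloc : ∀ {T T₁ T₂ : C} (c₁ : T₁ ⟶ T) (c₂ : T₂ ⟶ T) (x y : T ⟶ X), JointCover c₁ c₂ →
      (∃ g : T₁ ⟶ R, g ≫ p₁ = c₁ ≫ x ∧ g ≫ p₂ = c₁ ≫ y) →
      (∃ g : T₂ ⟶ R, g ≫ p₁ = c₂ ≫ x ∧ g ≫ p₂ = c₂ ≫ y) →
      ∃ g : T ⟶ R, g ≫ p₁ = x ∧ g ≫ p₂ = y := by
    rintro T T₁ T₂ c₁ c₂ x y hc ⟨g₁, h₁, h₁'⟩ ⟨g₂, h₂, h₂'⟩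
    have : Mono (prod.lift p₁ p₂) := ⟨fun f g e => hm.right_cancellation _ _
      (by simpa using e =≫ prod.fst) (by simpa using e =≫ prod.snd)⟩
    obtain ⟨g, hg⟩ := hc.exists_factor (prod.lift p₁ p₂) (x := prod.lift x y) (u₁ := g₁)
      (u₂ := g₂) (by apply prod.hom_ext <;> simpa) (by apply prod.hom_ext <;> simpa)
    exact ⟨g, by simpa using hg =≫ prod.fst, by simpa using hg =≫ prod.snd⟩
  obtain ⟨r, hr₁, hr₂⟩ := (hR (𝟙 X) (𝟙 X)).mpr (.of_eq m h rfl)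
  obtain ⟨s, hs₁, hs₂⟩ : ∃ s : R ⟶ R, s ≫ p₁ = p₂ ∧ s ≫ p₂ = p₁ := by
    obtain ⟨T₁, T₂, c₁, c₂, hc, e, s, t, hs, ht, hst⟩ := (hR p₁ p₂).mp ⟨𝟙 R, by simp, by simp⟩
    exact (hR p₂ p₁).mpr ⟨T₁, T₂, c₁, c₂, hc, e.symm, t, s, ht, hs, hst.symm⟩
  obtain ⟨t, ht₁, ht₂⟩ : ∃ t : pullback p₂ p₁ ⟶ R, t ≫ p₁ = pullback.fst p₂ p₁ ≫ p₁ ∧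
      t ≫ p₂ = pullback.snd p₂ p₁ ≫ p₂ := by
    obtain ⟨T₁, T₂, c₁, c₂, hc, e, s, t, hs, ht, hst⟩ :=
      (hR (pullback.fst p₂ p₁ ≫ p₁) (pullback.fst p₂ p₁ ≫ p₂)).mp ⟨_, rfl, rfl⟩
    refine hloc c₁ c₂ _ _ hc
      ⟨c₁ ≫ pullback.snd p₂ p₁, by rw [Category.assoc, ← pullback.condition, e], by simp⟩ ?_
    obtain ⟨T₁', T₂', c₁', c₂', hc', e', s', t', hs', ht', hst'⟩ :=
      (hR (c₂ ≫ pullback.snd p₂ p₁ ≫ p₁) (c₂ ≫ pullback.snd p₂ p₁ ≫ p₂)).mp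
        ⟨c₂ ≫ pullback.snd p₂ p₁, by simp, by simp⟩
    refine hloc c₁' c₂' _ _ hc' ⟨c₁' ≫ c₂ ≫ pullback.fst p₂ p₁, by simp, ?_⟩
      ((hR _ _).mpr ?_)
    · rw [← e', ← pullback.condition]; simp
    -- The case where neither step is an equality: as `m` is monic, the two lifts of the middle
    -- element to `S` agree, so the equalities under `h` chain.
    · have key : c₂' ≫ t = s' := by
        rw [← cancel_mono m, hs', Category.assoc, ht, pullback.condition]
      rw [← hs, ← ht', ← Category.assoc]
      exact .of_factor m h _ _ (by rw [Category.assoc, hst, ← hst', ← key, Category.assoc])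
  obtain ⟨Q, q, hq⟩ := IsBarrExact.effective p₁ p₂
    ⟨⟨{ hm with
        r := r, reflexivity₁ := hr₁, reflexivity₂ := hr₂
        s := s, symmetry₁ := hs₁, symmetry₂ := hs₂
        c := _, isLimit := pullbackIsPullback p₂ p₁
        t := t, transitivity₁ := ht₁, transitivity₂ := ht₂ }⟩⟩
  refine ⟨Q, q, fun x y => ⟨fun e => ?_, fun e => ?_⟩⟩
  · exact (hR x y).mp ⟨hq.lift x y e, hq.lift_fst _ _ _, hq.lift_snd _ _ _⟩
  · obtain ⟨g, rfl, rfl⟩ := (hR x y).mpr e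
    rw [Category.assoc, hq.w, Category.assoc]

end Collapse

/-! ### Amalgams along a mono -/

section Amalgam

variable {C : Type u} [Category.{v} C]

section

variable [Regular C] [FinitaryExtensive C]

/-- A generalized element of `A ⨿ Y` whose image in `X ⨿ Y'` lies in `X` comes from `A`. -/
theorem exists_factor_inl_of_comp_map {A X Y Y' T : C} (m : A ⟶ X) (n : Y ⟶ Y') {s : T ⟶ A ⨿ Y}
    {x : T ⟶ X} (h : s ≫ coprod.map m n = x ≫ coprod.inl) :
    ∃ s' : T ⟶ A, s' ≫ coprod.inl = s ∧ s' ≫ m = x := by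
  obtain ⟨T₁, T₂, c₁, c₂, s₁, s₂, ⟨hc⟩, h₁, h₂⟩ := exists_isColimit_binaryCofan_of_hom_coprod s
  have e : (c₂ ≫ x) ≫ (coprod.inl : X ⟶ X ⨿ Y') = (s₂ ≫ n) ≫ coprod.inr := by
    rw [Category.assoc, ← h, reassoc_of% h₂, coprod.inr_map, Category.assoc]
  -- The piece of `T` lying over `Y` maps into both summands of `X ⨿ Y'`, so it is initial and
  -- imposes no condition.
  obtain ⟨hi⟩ := nonempty_isInitial_of_comp_inl_eq_comp_inr e
  obtain ⟨s', hs'⟩ := (JointCover.of_isColimit hc).exists_factor (coprod.inl : A ⟶ A ⨿ Y)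
    (x := s) (u₁ := s₁) (u₂ := hi.to A) h₁.symm (hi.hom_ext _ _)
  refine ⟨s', hs', ?_⟩
  rw [← cancel_mono (coprod.inl : X ⟶ X ⨿ Y'), ← h, ← hs', Category.assoc, Category.assoc,
    coprod.inl_map]

/-- A generalized element of `A ⨿ Y` whose image in `X ⨿ Y'` lies in `Y'` comes from `Y`. -/
theorem exists_factor_inr_of_comp_map {A X Y Y' T : C} (m : A ⟶ X) (n : Y ⟶ Y') {s : T ⟶ A ⨿ Y}
    {y : T ⟶ Y'} (h : s ≫ coprod.map m n = y ≫ coprod.inr) :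
    ∃ s' : T ⟶ Y, s' ≫ coprod.inr = s ∧ s' ≫ n = y := by
  obtain ⟨T₁, T₂, c₁, c₂, s₁, s₂, ⟨hc⟩, h₁, h₂⟩ := exists_isColimit_binaryCofan_of_hom_coprod s
  have e : (s₁ ≫ m) ≫ (coprod.inl : X ⟶ X ⨿ Y') = (c₁ ≫ y) ≫ coprod.inr := by
    rw [Category.assoc _ y, ← h, reassoc_of% h₁, coprod.inl_map, Category.assoc]
  obtain ⟨hi⟩ := nonempty_isInitial_of_comp_inl_eq_comp_inr e
  obtain ⟨s', hs'⟩ := (JointCover.of_isColimit hc).exists_factor (coprod.inr : Y ⟶ A ⨿ Y)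
    (x := s) (u₁ := hi.to Y) (u₂ := s₂) (hi.hom_ext _ _) h₂.symm
  refine ⟨s', hs', ?_⟩
  rw [← cancel_mono (coprod.inr : Y' ⟶ X ⨿ Y'), ← h, ← hs', Category.assoc, Category.assoc,
    coprod.inr_map]

theorem mono_coprod_map {A X Y Y' : C} (m : A ⟶ X) (n : Y ⟶ Y') [Mono m] [Mono n] :
    Mono (coprod.map m n) := by
  refine ⟨fun {T} s t h => ?_⟩
  obtain ⟨T₁, T₂, c₁, c₂, s₁, s₂, ⟨hc⟩, h₁, h₂⟩ := exists_isColimit_binaryCofan_of_hom_coprod s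
  refine (JointCover.of_isColimit hc).hom_ext ?_ ?_
  · obtain ⟨t', ht', ht''⟩ := exists_factor_inl_of_comp_map m n (s := c₁ ≫ t) (x := s₁ ≫ m) (by
      rw [Category.assoc, ← h, reassoc_of% h₁, coprod.inl_map, Category.assoc])
    rw [h₁, ← ht', (cancel_mono m).mp ht'']
  · obtain ⟨t', ht', ht''⟩ := exists_factor_inr_of_comp_map m n (s := c₂ ≫ t) (y := s₂ ≫ n) (by
      rw [Category.assoc, ← h, reassoc_of% h₂, coprod.inr_map, Category.assoc])
    rw [h₂, ← ht', (cancel_mono n).mp ht'']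

end

variable [IsPretopos C]

/-- Every span in a pretopos with a monic leg can be completed to a commutative square which is a
pullback, has a monic leg, and identifies only what has to be identified. -/
theorem exists_amalgam {A X Y : C} (m : A ⟶ X) [Mono m] (f : A ⟶ Y) :
    ∃ (Q : C) (a : X ⟶ Q) (b : Y ⟶ Q), m ≫ a = f ≫ b ∧ Mono b ∧
      (∀ {T : C} (x : T ⟶ X) (y : T ⟶ Y), x ≫ a = y ≫ b → ∃ s : T ⟶ A, s ≫ m = x ∧ s ≫ f = y) ∧
      ∀ {T : C} (x y : T ⟶ X), x ≫ a = y ≫ a → CollapseRel m f x y := by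
  have := mono_coprod_map m (𝟙 Y)
  -- Gluing `a` to `f a` is a collapse of `X ⨿ Y` along the subobject `A ⨿ Y`, which retracts onto
  -- `Y` by `f` and the identity.
  obtain ⟨Q, q, hq⟩ := exists_collapse (coprod.map m (𝟙 Y)) (coprod.desc f (𝟙 Y))
  refine ⟨Q, coprod.inl ≫ q, coprod.inr ≫ q, ?_, ⟨fun {T} x y e => ?_⟩, fun {T} x y e => ?_,
    fun {T} x y e => ?_⟩
  · have := (hq _ _).mpr (.of_factor (coprod.map m (𝟙 Y)) (coprod.desc f (𝟙 Y)) coprod.inl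
      (f ≫ coprod.inr) (by simp))
    simpa using this
  · obtain ⟨T₁, T₂, c₁, c₂, hc, e₁, s, t, hs, ht, hst⟩ :=
      (hq (x ≫ coprod.inr) (y ≫ coprod.inr)).mp (by simpa using e)
    refine hc.hom_ext ?_ ?_
    · rw [← cancel_mono (coprod.inr : Y ⟶ X ⨿ Y), Category.assoc, e₁, Category.assoc]
    · obtain ⟨s', rfl, hs'⟩ := exists_factor_inr_of_comp_map m (𝟙 Y) (s := s) (y := c₂ ≫ x)
        (by rw [hs, Category.assoc])
      obtain ⟨t', rfl, ht'⟩ := exists_factor_inr_of_comp_map m (𝟙 Y) (s := t) (y := c₂ ≫ y)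
        (by rw [ht, Category.assoc])
      rw [← hs', ← ht']
      simpa using hst
  · obtain ⟨T₁, T₂, c₁, c₂, hc, e₁, s, t, hs, ht, hst⟩ :=
      (hq (x ≫ coprod.inl) (y ≫ coprod.inr)).mp (by simpa using e)
    obtain ⟨hi⟩ := nonempty_isInitial_of_comp_inl_eq_comp_inr (x := c₁ ≫ x) (y := c₁ ≫ y)
      (by simpa using e₁)
    obtain ⟨s', rfl, hs'⟩ := exists_factor_inl_of_comp_map m (𝟙 Y) (s := s) (x := c₂ ≫ x)
      (by rw [hs, Category.assoc])
    obtain ⟨t', rfl, ht'⟩ := exists_factor_inr_of_comp_map m (𝟙 Y) (s := t) (y := c₂ ≫ y)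
      (by rw [ht, Category.assoc])
    -- Gluing the local lifts along this mono yields the conditions on `x` and `y` together.
    have : Mono (prod.lift m f) := mono_of_mono_fac (prod.lift_fst m f)
    have hst' : s' ≫ f = t' := by simpa using hst
    obtain ⟨w, hw⟩ := hc.exists_factor (prod.lift m f) (x := prod.lift x y) (u₁ := hi.to A)
      (u₂ := s') (hi.hom_ext _ _) (by
        apply prod.hom_ext
        · simpa using hs'
        · simpa [hst'] using ht')
    exact ⟨w, by simpa using hw =≫ prod.fst, by simpa using hw =≫ prod.snd⟩
  · obtain ⟨T₁, T₂, c₁, c₂, hc, e₁, s, t, hs, ht, hst⟩ :=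
      (hq (x ≫ coprod.inl) (y ≫ coprod.inl)).mp (by simpa using e)
    obtain ⟨s', rfl, hs'⟩ := exists_factor_inl_of_comp_map m (𝟙 Y) (s := s) (x := c₂ ≫ x)
      (by rw [hs, Category.assoc])
    obtain ⟨t', rfl, ht'⟩ := exists_factor_inl_of_comp_map m (𝟙 Y) (s := t) (x := c₂ ≫ y)
      (by rw [ht, Category.assoc])
    refine ⟨T₁, T₂, c₁, c₂, hc, ?_, s', t', hs', ht', by simpa using hst⟩
    rw [← cancel_mono (coprod.inl : X ⟶ X ⨿ Y), Category.assoc, e₁, Category.assoc]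

/-! ### Pushouts, corelations and subobjects in a pretopos -/

namespace IsPretopos

section Pushout

variable {A X Y P : C} {m : A ⟶ X} {f : A ⟶ Y} {a : X ⟶ P} {b : Y ⟶ P} [Mono m]

/-- The amalgam `Q` need not be known to be a pushout: any pushout maps to it compatibly, so
equalities in the pushout persist in `Q`. The next two lemmas use the same comparison. -/
theorem mono_of_isPushout (sq : IsPushout m f a b) : Mono b := by
  obtain ⟨Q, a', b', w, hb, -⟩ := exists_amalgam m f
  exact mono_of_mono_fac (sq.inr_desc a' b' w)

theorem exists_factor_of_isPushout (sq : IsPushout m f a b) {T : C} {x : T ⟶ X} {y : T ⟶ Y}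
    (e : x ≫ a = y ≫ b) : ∃ s : T ⟶ A, s ≫ m = x ∧ s ≫ f = y := by
  obtain ⟨Q, a', b', w, -, h, -⟩ := exists_amalgam m f
  exact h x y (by rw [← sq.inl_desc a' b' w, reassoc_of% e, sq.inr_desc])

theorem collapseRel_of_isPushout (sq : IsPushout m f a b) {T : C} {x y : T ⟶ X}
    (e : x ≫ a = y ≫ a) : CollapseRel m f x y := by
  obtain ⟨Q, a', b', w, -, -, h⟩ := exists_amalgam m f
  exact h x y (by rw [← sq.inl_desc a' b' w, reassoc_of% e])

end Pushout

instance (priority := 100) isRegularMonoCategory : IsRegularMonoCategory C where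
  regularMonoOfMono {A X} m _ := by
    -- Collapsing `A` to a point exhibits `m` as the equalizer of `a` and the constant map at that
    -- point.
    obtain ⟨Q, a, b, w, -, h, -⟩ := exists_amalgam m (terminal.from A)
    refine ⟨⟨{ Z := Q, left := a, right := terminal.from X ≫ b, w := ?_, isLimit := ?_ }⟩⟩
    · rw [w, ← Category.assoc, Subsingleton.elim (m ≫ terminal.from X) (terminal.from A)]
    · refine Fork.IsLimit.mk' _ fun s => ?_
      have hs := h s.ι (s.ι ≫ terminal.from X) (by rw [s.condition, Category.assoc])
      refine ⟨hs.choose, hs.choose_spec.1, fun {k} hk => ?_⟩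
      rw [← cancel_mono m]
      exact hk.trans hs.choose_spec.1.symm

/-- The monic part of the image factorization is also epic, hence invertible because monos are
regular. -/
theorem isRegularEpi_of_epi {X Y : C} (e : X ⟶ Y) [Epi e] : IsRegularEpi e := by
  let F := Regular.strongEpiMonoFactorisation e
  have : Epi F.m := epi_of_epi_fac F.fac
  have : IsIso F.m := isIso_of_mono_of_epi F.m
  rw [← F.fac]
  exact (MorphismProperty.cancel_right_of_respectsIso (.regularEpi C) F.e F.m).mpr
    (show IsRegularEpi F.e from inferInstance)

/-- A coreflexive corelation in a pretopos is a cokernel pair. -/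
theorem isPushout_of_coreflexive {X R U : C} {p q : X ⟶ R} {r : R ⟶ X} (hp : p ≫ r = 𝟙 X)
    (hq : q ≫ r = 𝟙 X)
    (hpq : ∀ {Z : C} (f g : R ⟶ Z), p ≫ f = p ≫ g → q ≫ f = q ≫ g → f = g)
    {i : U ⟶ X} (hi : i ≫ p = i ≫ q)
    (hi' : ∀ {T : C} (x : T ⟶ X), x ≫ p = x ≫ q → ∃ s, s ≫ i = x) : IsPushout i i p q := by
  have : Epi (coprod.desc p q) := ⟨fun f g e => hpq f g
    (by simpa using coprod.inl ≫= e) (by simpa using coprod.inr ≫= e)⟩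
  have := isRegularEpi_of_epi (coprod.desc p q)
  have hpinj : ∀ {T : C} (x y : T ⟶ X), x ≫ p = y ≫ p → x = y := fun x y e => by
    simpa [hp] using e =≫ r
  have hqinj : ∀ {T : C} (x y : T ⟶ X), x ≫ q = y ≫ q → x = y := fun x y e => by
    simpa [hq] using e =≫ r
  -- Applying `r` shows that elements of the two copies of `X` can be identified in `R` only if they
  -- are the same element, lying in the equalizer `U`.
  have hcross : ∀ {T Z : C} (x y : T ⟶ X) (a b : X ⟶ Z), i ≫ a = i ≫ b → x ≫ p = y ≫ q →
      x ≫ a = y ≫ b := fun x y a b w e => by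
    obtain rfl : x = y := by simpa [hp, hq] using e =≫ r
    obtain ⟨s, rfl⟩ := hi' x e
    rw [Category.assoc, w, Category.assoc]
  have hdesc : ∀ {Z : C} (a b : X ⟶ Z), i ≫ a = i ≫ b → ∃ d : R ⟶ Z, p ≫ d = a ∧ q ≫ d = b := by
    intro Z a b w
    -- Four cases, by the summands in which `k` and `l` lie: within one summand `p` or `q` is
    -- injective, across summands `hcross` applies.
    have key : ∀ {T : C} (k l : T ⟶ X ⨿ X), k ≫ coprod.desc p q = l ≫ coprod.desc p q →
        k ≫ coprod.desc a b = l ≫ coprod.desc a b := by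
      intro T k l e
      obtain ⟨T₁, T₂, c₁, c₂, k₁, k₂, ⟨hc⟩, h₁, h₂⟩ := exists_isColimit_binaryCofan_of_hom_coprod k
      refine (JointCover.of_isColimit hc).hom_ext ?_ ?_
      · obtain ⟨T₁', T₂', c₁', c₂', l₁, l₂, ⟨hc'⟩, h₁', h₂'⟩ :=
          exists_isColimit_binaryCofan_of_hom_coprod (c₁ ≫ l)
        refine (JointCover.of_isColimit hc').hom_ext ?_ ?_
        · have := c₁' ≫= c₁ ≫= e
          rw [reassoc_of% h₁, reassoc_of% h₁', coprod.inl_desc] at this ⊢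
          rw [← hpinj (c₁' ≫ k₁) l₁ (by simpa using this), Category.assoc]
        · have := c₂' ≫= c₁ ≫= e
          rw [reassoc_of% h₁, reassoc_of% h₂', coprod.inl_desc, coprod.inr_desc] at this ⊢
          simpa using hcross (c₂' ≫ k₁) l₂ a b w (by simpa using this)
      · obtain ⟨T₁', T₂', c₁', c₂', l₁, l₂, ⟨hc'⟩, h₁', h₂'⟩ :=
          exists_isColimit_binaryCofan_of_hom_coprod (c₂ ≫ l)
        refine (JointCover.of_isColimit hc').hom_ext ?_ ?_
        · have := c₁' ≫= c₂ ≫= e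
          rw [reassoc_of% h₂, reassoc_of% h₁', coprod.inr_desc, coprod.inl_desc] at this ⊢
          simpa using (hcross l₁ (c₁' ≫ k₂) a b w (by simpa using this.symm)).symm
        · have := c₂' ≫= c₂ ≫= e
          rw [reassoc_of% h₂, reassoc_of% h₂', coprod.inr_desc] at this ⊢
          rw [← hqinj (c₂' ≫ k₂) l₂ (by simpa using this), Category.assoc]
    let d := IsRegularEpi.desc (coprod.desc p q) (coprod.desc a b)
      (key _ _ (IsRegularEpi.w (coprod.desc p q)))
    have hd : coprod.desc p q ≫ d = coprod.desc a b := IsRegularEpi.fac _ _ _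
    exact ⟨d, by simpa using coprod.inl ≫= hd, by simpa using coprod.inr ≫= hd⟩
  refine ⟨⟨hi⟩, ⟨PushoutCocone.IsColimit.mk _ (fun s => (hdesc s.inl s.inr s.condition).choose)
    (fun s => (hdesc s.inl s.inr s.condition).choose_spec.1)
    (fun s => (hdesc s.inl s.inr s.condition).choose_spec.2) fun s d h₁ h₂ => ?_⟩⟩
  exact hpq _ _ (h₁.trans (hdesc s.inl s.inr s.condition).choose_spec.1.symm)
    (h₂.trans (hdesc s.inl s.inr s.condition).choose_spec.2.symm)

/-- A morphism between objects with a common subobject `B` is invertible as soon as it becomes so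
after pushing out along a morphism with domain `B`. -/
theorem isIso_of_isPushout {B E A A' P P' : C} {p : B ⟶ E} {α : B ⟶ A} {α' : B ⟶ A'} [Mono α]
    [Mono α'] {i : A ⟶ P} {j : E ⟶ P} {i' : A' ⟶ P'} {j' : E ⟶ P'} (sq : IsPushout α p i j)
    (sq' : IsPushout α' p i' j') (f : A ⟶ A') (hf : α ≫ f = α') (g : P ⟶ P') [IsIso g]
    (hi : i ≫ g = f ≫ i') (hj : j ≫ g = j') : IsIso f := by
  have hmono : Mono f := by
    refine ⟨fun {T} x y e => ?_⟩
    have e' : x ≫ i = y ≫ i := by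
      rw [← cancel_mono g, Category.assoc, hi, reassoc_of% e, Category.assoc, hi]
    obtain ⟨T₁, T₂, c₁, c₂, hc, e₁, s, t, hs, ht, -⟩ := collapseRel_of_isPushout sq e'
    refine hc.hom_ext e₁ ?_
    have : s = t := by
      rw [← cancel_mono α', ← hf, reassoc_of% hs, reassoc_of% ht, e]
    rw [← hs, ← ht, this]
  have hepi : Epi f := by
    refine ⟨fun {Z} u v e => ?_⟩
    have : Epi (coprod.desc i j) := ⟨fun k l e => sq.hom_ext
      (by simpa using coprod.inl ≫= e) (by simpa using coprod.inr ≫= e)⟩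
    have hcov : JointCover i j := isRegularEpi_of_epi (coprod.desc i j)
    have hB : α' ≫ u = α' ≫ v := by rw [← hf, Category.assoc, e, Category.assoc]
    -- The generic element of `A'`, viewed in `P`, comes locally from `A` or from `E`. It then lies
    -- locally in the image of `f` or in `B`, and `u` and `v` agree on both.
    obtain ⟨T₁, T₂, c₁, c₂, t₁, t₂, hc, h₁, h₂⟩ := hcov.exists_of_hom (i' ≫ inv g)
    have h₁' : c₁ ≫ i' = (t₁ ≫ f) ≫ i' := by
      rw [Category.assoc, ← hi, ← reassoc_of% h₁, IsIso.inv_hom_id, Category.comp_id]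
    have h₂' : c₂ ≫ i' = t₂ ≫ j' := by
      rw [← hj, ← reassoc_of% h₂, IsIso.inv_hom_id, Category.comp_id]
    refine hc.hom_ext ?_ ?_
    · obtain ⟨T₁', T₂', c₁', c₂', hc', e₁, s, t, hs, ht, -⟩ := collapseRel_of_isPushout sq' h₁'
      refine hc'.hom_ext ?_ ?_
      · rw [reassoc_of% e₁, reassoc_of% e₁, e]
      · rw [← reassoc_of% hs, ← reassoc_of% hs, hB]
    · obtain ⟨s, hs, -⟩ := exists_factor_of_isPushout sq' h₂'
      rw [← hs, Category.assoc, hB, Category.assoc]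
  exact isIso_of_mono_of_epi f

/-- Binary meets of subobjects distribute over binary joins. -/
theorem subobject_inf_sup_le {X : C} (S U V : Subobject X) :
    S ⊓ (U ⊔ V) ≤ (S ⊓ U) ⊔ (S ⊓ V) := by
  let F := Regular.strongEpiMonoFactorisation (coprod.desc U.arrow V.arrow)
  have h₁ : coprod.inl ≫ F.e ≫ F.m = U.arrow := by simp
  have h₂ : coprod.inr ≫ F.e ≫ F.m = V.arrow := by simp
  have hF : coprod.desc (coprod.inl ≫ F.e) (coprod.inr ≫ F.e) = F.e := by
    apply coprod.hom_ext <;> simp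
  have cov : JointCover (coprod.inl ≫ F.e) (coprod.inr ≫ F.e) := by
    unfold JointCover
    rw [hF]
    infer_instance
  have hle : U ⊔ V ≤ Subobject.mk F.m := sup_le
    (Subobject.le_of_factors ((Subobject.mk_factors_iff _ _).mpr ⟨coprod.inl ≫ F.e, by simp [F]⟩))
    (Subobject.le_of_factors ((Subobject.mk_factors_iff _ _).mpr ⟨coprod.inr ≫ F.e, by simp [F]⟩))
  let W := S ⊓ (U ⊔ V)
  obtain ⟨x, hx⟩ : ∃ x : (W : C) ⟶ F.I, x ≫ F.m = W.arrow := (Subobject.mk_factors_iff _ _).mp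
    (Subobject.factors_of_le _ (inf_le_right.trans hle) (Subobject.factors_self W))
  obtain ⟨T₁, T₂, c₁, c₂, t₁, t₂, hc, e₁, e₂⟩ := cov.exists_of_hom x
  have hS : S.Factors W.arrow := Subobject.factors_of_le _ inf_le_left (Subobject.factors_self W)
  have f₁ : (S ⊓ U).Factors (c₁ ≫ W.arrow) := by
    refine (Subobject.inf_factors _).mpr ⟨Subobject.factors_of_factors_right c₁ hS, ?_⟩
    have : c₁ ≫ W.arrow = t₁ ≫ U.arrow := by
      rw [← hx]
      simpa using e₁ =≫ F.m
    rw [this]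
    exact Subobject.factors_comp_arrow t₁
  have f₂ : (S ⊓ V).Factors (c₂ ≫ W.arrow) := by
    refine (Subobject.inf_factors _).mpr ⟨Subobject.factors_of_factors_right c₂ hS, ?_⟩
    have : c₂ ≫ W.arrow = t₂ ≫ V.arrow := by
      rw [← hx]
      simpa using e₂ =≫ F.m
    rw [this]
    exact Subobject.factors_comp_arrow t₂
  have g₁ := Subobject.sup_factors_of_factors_left (Y := S ⊓ V) f₁
  have g₂ := Subobject.sup_factors_of_factors_right (X := S ⊓ U) f₂
  obtain ⟨u, hu⟩ := hc.exists_factor ((S ⊓ U) ⊔ (S ⊓ V)).arrow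
    (Subobject.factorThru_arrow _ _ g₁) (Subobject.factorThru_arrow _ _ g₂)
  refine Subobject.le_of_factors ?_
  rw [show (S ⊓ (U ⊔ V)).arrow = _ from hu.symm]
  exact Subobject.factors_comp_arrow u

end IsPretopos

end Amalgam

/-- An order isomorphic to a distributive lattice is a distributive lattice order. -/
theorem isDistribLatticeOrder_of_orderIso {P Q : Type*} [inst : PartialOrder P]
    [DistribLattice Q] (e : P ≃o Q) : IsDistribLatticeOrder P :=
  ⟨{ inst with
      sup := fun a b => e.symm (e a ⊔ e b)
      inf := fun a b => e.symm (e a ⊓ e b)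
      le_sup_left := fun a b => (e.le_symm_apply).mpr le_sup_left
      le_sup_right := fun a b => (e.le_symm_apply).mpr le_sup_right
      sup_le := fun a b c h₁ h₂ =>
        (e.symm_apply_le).mpr (sup_le (e.monotone h₁) (e.monotone h₂))
      inf_le_left := fun a b => (e.symm_apply_le).mpr inf_le_left
      inf_le_right := fun a b => (e.symm_apply_le).mpr inf_le_right
      le_inf := fun a b c h₁ h₂ =>
        (e.le_symm_apply).mpr (le_inf (e.monotone h₁) (e.monotone h₂))
      le_sup_inf := fun a b c => by
        change e.symm (e (e.symm (e a ⊔ e b)) ⊓ e (e.symm (e a ⊔ e c))) ≤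
          e.symm (e a ⊔ e (e.symm (e b ⊓ e c)))
        simp only [e.apply_symm_apply]
        exact e.symm.monotone le_sup_inf }, rfl⟩

theorem IsKernelPair.isEquivalenceRelation {C : Type u} [Category.{v} C] [HasPullbacks C]
    {X Y R : C} {f : X ⟶ Y} {p₁ p₂ : R ⟶ X} (h : IsKernelPair f p₁ p₂) :
    IsEquivalenceRelation p₁ p₂ :=
  (IsKernelPair.equivalenceRelation f p₁ p₂ (pullbackIsPullback p₂ p₁) h).isEquivalenceRelation

namespace SplitPoint

variable {C : Type u} [Category.{v} C] {B : C} {P Q : SplitPoint B}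

theorem isIso_of_isIso_hom (f : P ⟶ Q) (h : IsIso (Hom.hom f)) : IsIso f :=
  ⟨⟨⟨inv (Hom.hom f), by rw [IsIso.inv_comp_eq, f.hom_proj], by
      rw [IsIso.comp_inv_eq, f.sect_hom]⟩,
    Hom.ext (IsIso.hom_inv_id (Hom.hom f)), Hom.ext (IsIso.inv_hom_id (Hom.hom f))⟩⟩

theorem isIso_hom (f : P ⟶ Q) [IsIso f] : IsIso (Hom.hom f) :=
  ⟨⟨Hom.hom (inv f), congrArg Hom.hom (IsIso.hom_inv_id f),
    congrArg Hom.hom (IsIso.inv_hom_id f)⟩⟩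

end SplitPoint

/-! ### Translation to the opposite category -/

namespace IsPretopos

variable {C : Type u} [Category.{v} C] [IsPretopos C]

/-- Subobjects in a pretopos form a distributive lattice. -/
noncomputable abbrev subobjectDistribLattice (X : C) : DistribLattice (Subobject X) :=
  DistribLattice.ofInfSupLe subobject_inf_sup_le

section Reflexive

variable {R X : Cᵒᵖ} {p₁ p₂ : R ⟶ X}

/-- In the opposite of a pretopos, every reflexive relation is a kernel pair. -/
theorem isKernelPair_of_reflexiveRelation (h : ReflexiveRelation p₁ p₂) :
    IsKernelPair (equalizer.ι p₁.unop p₂.unop).op p₁ p₂ :=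
  (isPushout_of_coreflexive (r := h.r.unop) (congrArg Quiver.Hom.unop h.reflexivity₁)
    (congrArg Quiver.Hom.unop h.reflexivity₂)
    (fun f g e₁ e₂ => Quiver.Hom.op_inj (h.right_cancellation f.op g.op
      (Quiver.Hom.unop_inj e₁) (Quiver.Hom.unop_inj e₂)))
    (equalizer.condition p₁.unop p₂.unop)
    (fun x hx => ⟨equalizer.lift x hx, equalizer.lift_ι x hx⟩)).op.flip

theorem exists_factor_of_isKernelPair_op {U : C} {i : U ⟶ X.unop} [Mono i]
    (h : IsKernelPair i.op p₁ p₂) {T : C} {x : T ⟶ X.unop} (e : x ≫ p₁.unop = x ≫ p₂.unop) :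
    ∃ s : T ⟶ U, s ≫ i = x := by
  have sq : IsPushout i i p₁.unop p₂.unop := IsPullback.unop (IsPullback.flip h)
  obtain ⟨s, hs, -⟩ := exists_factor_of_isPushout sq e
  exact ⟨s, hs⟩

end Reflexive

/-- The subobject of `X` on which the two projections of an equivalence relation on `X` in the
opposite category coincide. -/
noncomputable def equivRelOnSubobject {X : Cᵒᵖ} (R : EquivRelOn X) : Subobject X.unop :=
  Subobject.mk (equalizer.ι (R.1.arrow ≫ prod.fst).unop (R.1.arrow ≫ prod.snd).unop)

theorem isKernelPair_equivRelOn {X : Cᵒᵖ} (R : EquivRelOn X) :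
    IsKernelPair (equalizer.ι (R.1.arrow ≫ prod.fst).unop (R.1.arrow ≫ prod.snd).unop).op
      (R.1.arrow ≫ prod.fst) (R.1.arrow ≫ prod.snd) := by
  obtain ⟨h⟩ := R.2.nonempty_equivalenceRelation
  exact isKernelPair_of_reflexiveRelation h.toReflexiveRelation

/-- Each relation is the kernel pair, in the opposite category, of its own equalizer, so shrinking
the equalizer enlarges the relation. Conversely, projections of the smaller relation factor through
those of the larger, so in `C` they agree wherever the latter do. -/
theorem equivRelOnSubobject_le_iff {X : Cᵒᵖ} (R S : EquivRelOn X) :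
    equivRelOnSubobject S ≤ equivRelOnSubobject R ↔ R ≤ S := by
  constructor
  · intro h
    let j := Subobject.ofMkLEMk _ _ h
    have hj : j ≫ equalizer.ι (R.1.arrow ≫ prod.fst).unop (R.1.arrow ≫ prod.snd).unop =
      equalizer.ι (S.1.arrow ≫ prod.fst).unop (S.1.arrow ≫ prod.snd).unop :=
      Subobject.ofMkLEMk_comp h
    have w : (R.1.arrow ≫ prod.fst) ≫
        (equalizer.ι (S.1.arrow ≫ prod.fst).unop (S.1.arrow ≫ prod.snd).unop).op =
        (R.1.arrow ≫ prod.snd) ≫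
        (equalizer.ι (S.1.arrow ≫ prod.fst).unop (S.1.arrow ≫ prod.snd).unop).op := by
      rw [← hj, op_comp, ← Category.assoc, (isKernelPair_equivRelOn R).w, Category.assoc]
    refine Subobject.le_of_comm ((isKernelPair_equivRelOn S).lift _ _ w) ?_
    apply prod.hom_ext
    · rw [Category.assoc, (isKernelPair_equivRelOn S).lift_fst]
    · rw [Category.assoc, (isKernelPair_equivRelOn S).lift_snd]
  · intro h
    have hj : Subobject.ofLE R.1 S.1 h ≫ S.1.arrow = R.1.arrow := Subobject.ofLE_arrow h
    refine Subobject.mk_le_mk_of_comm (equalizer.lift (equalizer.ι _ _) ?_)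
      (equalizer.lift_ι _ _)
    have := equalizer.condition (S.1.arrow ≫ prod.fst).unop (S.1.arrow ≫ prod.snd).unop
    rw [← hj, Category.assoc, Category.assoc]
    exact (Category.assoc _ _ _).symm.trans
      ((this =≫ (Subobject.ofLE R.1 S.1 h).unop).trans (Category.assoc _ _ _))

/-- A mono is the equalizer of its cokernel pair, so the relation given by the cokernel pair of `U`
is a preimage. -/
theorem equivRelOnSubobject_surjective [HasFiniteColimits C] (X : Cᵒᵖ) :
    Function.Surjective (equivRelOnSubobject : EquivRelOn X → Subobject X.unop) := by
  intro U
  let i := U.arrow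
  let a := pullback.fst i.op i.op
  let b := pullback.snd i.op i.op
  have : Mono (prod.lift a b) := ⟨fun f g e => pullback.hom_ext
    (by simpa [a] using e =≫ prod.fst) (by simpa [b] using e =≫ prod.snd)⟩
  let R : Subobject (X ⨯ X) := Subobject.mk (prod.lift a b)
  let e := Subobject.underlyingIso (prod.lift a b)
  have he : e.hom ≫ prod.lift a b = R.arrow := Subobject.underlyingIso_hom_comp_eq_mk _
  have hR : IsKernelPair i.op (R.arrow ≫ prod.fst) (R.arrow ≫ prod.snd) := by
    rw [← he]
    refine IsPullback.of_iso (IsPullback.of_hasPullback i.op i.op) e.symm (Iso.refl _)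
      (Iso.refl _) (Iso.refl _) ?_ ?_ ?_ ?_ <;> simp [a, b]
  refine ⟨⟨R, IsKernelPair.isEquivalenceRelation hR⟩, le_antisymm ?_ ?_⟩
  · obtain ⟨s, hs⟩ := exists_factor_of_isKernelPair_op hR
      (equalizer.condition (R.arrow ≫ prod.fst).unop (R.arrow ≫ prod.snd).unop)
    exact Subobject.mk_le_of_comm s hs
  · exact Subobject.le_mk_of_comm (equalizer.lift i (congrArg Quiver.Hom.unop hR.w))
      (equalizer.lift_ι _ _)

/-- Equivalence relations in the opposite of a pretopos correspond, contravariantly, to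
subobjects. -/
noncomputable def equivRelOnOrderIso [HasFiniteColimits C] (X : Cᵒᵖ) : EquivRelOn X ≃o (Subobject X.unop)ᵒᵈ :=
  have hle (R S : EquivRelOn X) : OrderDual.toDual (equivRelOnSubobject R) ≤
      OrderDual.toDual (equivRelOnSubobject S) ↔ R ≤ S := equivRelOnSubobject_le_iff R S
  { toEquiv := Equiv.ofBijective (fun R => OrderDual.toDual (equivRelOnSubobject R))
      ⟨fun R S h => le_antisymm ((hle R S).mp h.le) ((hle S R).mp h.ge),
        equivRelOnSubobject_surjective X⟩
    map_rel_iff' := fun {R S} => hle R S }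

theorem isArithmetical_op [HasFiniteColimits C] : IsArithmetical Cᵒᵖ where
  isEquivalenceRelation _ _ h :=
    IsKernelPair.isEquivalenceRelation (isKernelPair_of_reflexiveRelation h)
  isDistribLatticeOrder X :=
    letI := subobjectDistribLattice X.unop
    isDistribLatticeOrder_of_orderIso (equivRelOnOrderIso X)

variable [HasFiniteColimits C]

theorem isBarrExact_op : IsBarrExact Cᵒᵖ where
  hasCoequalizer_of_isKernelPair _ := inferInstance
  regularEpiIsStableUnderBaseChange :=
    ⟨fun {_ _ _ _ _ _ _ g'} sq (hg : IsRegularEpi _) => by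
      have := mono_of_isPushout sq.flip.unop
      have := IsRegularMonoCategory.regularMonoOfMono g'.unop
      exact (isRegularMono_unop_iff_isRegularEpi g').mp this⟩
  effective _ _ h := by
    obtain ⟨h⟩ := h.nonempty_equivalenceRelation
    exact ⟨_, _, isKernelPair_of_reflexiveRelation h.toReflexiveRelation⟩

theorem isProtomodular_op : IsProtomodular Cᵒᵖ :=
  have : HasPullbacksOfSplitEpis Cᵒᵖ := ⟨fun _ _ _ => inferInstance⟩
  { reflectsIsomorphisms := fun {_ B} p => ⟨fun {P Q} f hf => by
      let g : pullback p P.proj ⟶ pullback p Q.proj := SplitPoint.baseChangeMap p f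
      have hg : IsIso g := SplitPoint.isIso_hom ((SplitPoint.baseChange p).map f)
      have hg₁ : g ≫ pullback.fst p Q.proj = pullback.fst p P.proj := pullback.lift_fst _ _ _
      have hg₂ : g ≫ pullback.snd p Q.proj = pullback.snd p P.proj ≫ SplitPoint.Hom.hom f :=
        pullback.lift_snd _ _ _
      have hg' : IsIso g.unop := inferInstance
      have hmono (S : SplitPoint B) : Mono S.proj.unop := by
        have : S.proj.unop ≫ S.sect.unop = 𝟙 _ := congrArg Quiver.Hom.unop S.sect_proj
        exact mono_of_mono_fac this
      have := hmono P
      have := hmono Q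
      -- In `C` the morphism runs from `Q` to `P`, so `Q` comes first. The sections serve only to
      -- make the two inclusions of `B` monic.
      have hiso := isIso_of_isPushout (IsPullback.of_hasPullback p Q.proj).unop
        (IsPullback.of_hasPullback p P.proj).unop (SplitPoint.Hom.hom f).unop
        (congrArg Quiver.Hom.unop f.hom_proj)
        g.unop (congrArg Quiver.Hom.unop hg₂) (congrArg Quiver.Hom.unop hg₁)
      exact SplitPoint.isIso_of_isIso_hom f ((isIso_unop_iff _).mp hiso)⟩ }

theorem isIdeallyExact_op : IsIdeallyExact Cᵒᵖ :=
  { isBarrExact_op, isProtomodular_op with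
    hasFiniteColimits := inferInstance
    isRegularEpi_initial_to_terminal := by
      have : Mono (initial.to (⊤_ Cᵒᵖ)).unop := by
        have hi : IsInitial (⊤_ Cᵒᵖ).unop := initialUnopOfTerminal terminalIsTerminal
        exact hi.mono_from _
      have := IsRegularMonoCategory.regularMonoOfMono (initial.to (⊤_ Cᵒᵖ)).unop
      exact (isRegularMono_unop_iff_isRegularEpi _).mp this }

end IsPretopos

theorem mainTheorem1 (C : Type u) [Category.{v} C] [IsPretopos C] [HasFiniteColimits C] :
    IsArithmetical Cᵒᵖ ∧ IsIdeallyExact Cᵒᵖ :=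
  ⟨IsPretopos.isArithmetical_op, IsPretopos.isIdeallyExact_op⟩
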